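/- Let $L$ be an oriented 1-linkoid, given by a diagram: a generic immersion in the plane of one interval (running from its initial endpoint, the leg, to its terminal endpoint, the head) and finitely many (possibly zero) oriented circles, whose only singularities are finitely many transverse double points away from the two endpoints, with over/under information at every double point. Let $Q(L)$ be its fundamental quandle, generated by the arcs of the diagram (the pieces into which the curves are cut at the under-crossings), with one relation for every crossing: if $y$ is the over-arc, $x$ the incoming and $z$ the outgoing under-arc, the relation is $z = x \triangleleft y$ at a positive crossing and $x = z \triangleleft y$ at a negative one. Let $l, h \in Q(L)$ be the generators given by the arcs at the leg and at the head. A coloring of $L$ by a quandle $X$ is a quandle homomorphism $Q(L) \to X$; it is trivial if it is constant. Let $X$ be a finite quandle. The quandle counting matrix $\Phi_X(L)$ is the integer matrix with rows and columns indexed by the elements of $X$ whose entry $\Phi_X(L)_{i,j}$ is the number of quandle homomorphisms $f \colon Q(L) \to X$ with $f(l) = i$ and $f(h) = j$. Then the number of colorings of $L$ by $X$ is finite, and: 1. $\Phi_X(L)_{i,j} \ge 0$ for all $i, j \in X$. 2. $\Phi_X(L)_{i,i} \ge 1$ for all $i \in X$. 3. $\Phi_X(L)$ is the identity matrix if and only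 if $L$ is only trivially colorable by $X$, that is, every coloring of $L$ by $X$ is trivial. 4. $\sum_{i,j \in X} \Phi_X(L)_{i,j}$ is the number of all quandle homomorphisms $Q(L) \to X$. 5. If $X$ is homogeneous (the automorphism group $\mathrm{Aut}(X)$ acts transitively on $X$), then $\Phi_X(L)_{i,i} = \Phi_X(L)_{j,j}$ for all $i, j \in X$. 6. If $X$ is 2-homogeneous (the diagonal action of $\mathrm{Aut}(X)$ on $X^2$ has exactly as many orbits as the diagonal action of the full symmetric group of $X$), then $\Phi_X(L)_{i_1,j_1} = \Phi_X(L)_{i_2,j_2}$ for all $i_1 \ne j_1$ and $i_2 \ne j_2$ in $X$. -/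

import Mathlib

open scoped Topology ContDiff Quandles

/-! ## Quandles given by generators and relations

In Mathlib the quandle operation is a left action: `y ◃ x` is the image of `x` under the
symmetry at `y`. It is the operation usually written `x ◁ y` for right-acting quandles. -/

/-- Formal quandle words in the generators `A`. -/
inductive QuandleTerm (A : Type) : Type
  | of (a : A) : QuandleTerm A
  | act (s t : QuandleTerm A) : QuandleTerm A
  | invAct (s t : QuandleTerm A) : QuandleTerm A

namespace QuandleTerm

/-- The smallest congruence on quandle words that contains `R` and forces the quandle axioms. -/
inductive Congr {A : Type} (R : QuandleTerm A → QuandleTerm A → Prop) :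
    QuandleTerm A → QuandleTerm A → Prop
  | rel {s t} (h : R s t) : Congr R s t
  | refl (s) : Congr R s s
  | symm {s t} (h : Congr R s t) : Congr R t s
  | trans {s t u} (h : Congr R s t) (k : Congr R t u) : Congr R s u
  | act_congr {s s' t t'} (h : Congr R s s') (k : Congr R t t') : Congr R (act s t) (act s' t')
  | invAct_congr {s s' t t'} (h : Congr R s s') (k : Congr R t t') :
      Congr R (invAct s t) (invAct s' t')
  | self_distrib (s t u) : Congr R (act s (act t u)) (act (act s t) (act s u))
  | left_inv (s t) : Congr R (invAct s (act s t)) t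
  | right_inv (s t) : Congr R (act s (invAct s t)) t
  | fix (s) : Congr R (act s s) s

/-- The congruence generated by `R`, as a setoid. -/
def congrSetoid {A : Type} (R : QuandleTerm A → QuandleTerm A → Prop) :
    Setoid (QuandleTerm A) where
  r := Congr R
  iseqv := ⟨Congr.refl, Congr.symm, Congr.trans⟩

end QuandleTerm

/-- The quandle with generators `A` and relations `s = t` for all words with `R s t`. -/
def PresentedQuandle {A : Type} (R : QuandleTerm A → QuandleTerm A → Prop) : Type :=
  Quotient (QuandleTerm.congrSetoid R)

namespace PresentedQuandle

variable {A : Type} {R : QuandleTerm A → QuandleTerm A → Prop}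

/-- The class of a word in the presented quandle. -/
def mk (R : QuandleTerm A → QuandleTerm A → Prop) (t : QuandleTerm A) : PresentedQuandle R :=
  Quotient.mk (QuandleTerm.congrSetoid R) t

/-- The element of the presented quandle given by a generator. -/
def of (R : QuandleTerm A → QuandleTerm A → Prop) (a : A) : PresentedQuandle R :=
  mk R (QuandleTerm.of a)

instance : Quandle (PresentedQuandle R) where
  act := Quotient.map₂ QuandleTerm.act fun _ _ h _ _ k => QuandleTerm.Congr.act_congr h k
  invAct := Quotient.map₂ QuandleTerm.invAct fun _ _ h _ _ k => QuandleTerm.Congr.invAct_congr h k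
  self_distrib := by
    rintro ⟨s⟩ ⟨t⟩ ⟨u⟩
    exact Quotient.sound (QuandleTerm.Congr.self_distrib s t u)
  left_inv := by
    rintro ⟨s⟩ ⟨t⟩
    exact Quotient.sound (QuandleTerm.Congr.left_inv s t)
  right_inv := by
    rintro ⟨s⟩ ⟨t⟩
    exact Quotient.sound (QuandleTerm.Congr.right_inv s t)
  fix := by
    rintro ⟨s⟩
    exact Quotient.sound (QuandleTerm.Congr.fix s)

end PresentedQuandle

/-! ## Pointed quandles -/

universe u v

/-- An `n`-pointed quandle: a quandle together with an ordered `n`-tuple of basepoints. -/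
structure PointedQuandle (n : ℕ) where
  /-- the underlying quandle -/
  carrier : Type u
  [quandle : Quandle carrier]
  /-- the basepoints -/
  basepoint : Fin n → carrier

attribute [instance] PointedQuandle.quandle

/-- Homomorphisms of `n`-pointed quandles: quandle homomorphisms that respect the basepoints. -/
def PointedQuandle.Hom {n : ℕ} (P : PointedQuandle.{u} n) (X : PointedQuandle.{v} n) :
    Type (max u v) :=
  {f : P.carrier →◃ X.carrier // ∀ k, f (P.basepoint k) = X.basepoint k}

/-! ## Automorphisms and homogeneity -/

/-- The automorphism group `Aut(X)` of a quandle, as a group of permutations of `X`. -/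
def quandleAut (X : Type*) [Quandle X] : Subgroup (Equiv.Perm X) where
  carrier := {f | ∀ x y : X, f (x ◃ y) = f x ◃ f y}
  mul_mem' := by
    intro f g hf hg x y
    simp only [Equiv.Perm.mul_apply]
    rw [hg, hf]
  one_mem' := fun _ _ => rfl
  inv_mem' := by
    intro f hf x y
    rw [Equiv.Perm.inv_eq_iff_eq, hf]
    simp

/-- A quandle is homogeneous if its automorphism group acts transitively on it. -/
def IsHomogeneousQuandle (X : Type*) [Quandle X] : Prop :=
  ∀ x y : X, ∃ f ∈ quandleAut X, f x = y

/-- A quandle `X` is `n`-homogeneous if the diagonal action of `Aut(X)` on `X ^ n` has as few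
orbits as it possibly can, namely as many as the diagonal action of the full symmetric group. -/
def IsNHomogeneousQuandle (n : ℕ) (X : Type*) [Quandle X] : Prop :=
  Nat.card (MulAction.orbitRel.Quotient (quandleAut X) (Fin n → X)) =
    Nat.card (MulAction.orbitRel.Quotient (Equiv.Perm X) (Fin n → X))

/-! ## 1-linkoid diagrams -/

/-- The disjoint union of the unit interval and `n` circles. -/
abbrev LinkoidSource (n : ℕ) : Type := Set.Icc (0 : ℝ) 1 ⊕ (Fin n × UnitAddCircle)

namespace LinkoidSource

/-- Move a point by the (small) time `s` along the orientation of its component. Points of the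
interval are stopped at the endpoints. -/
noncomputable def shift {n : ℕ} : LinkoidSource n → ℝ → LinkoidSource n
  | Sum.inl t, s => Sum.inl (Set.projIcc 0 1 zero_le_one ((t : ℝ) + s))
  | Sum.inr (i, w), s => Sum.inr (i, w + (s : UnitAddCircle))

/-- The initial endpoint of the interval component. -/
def leg {n : ℕ} : LinkoidSource n := Sum.inl ⟨0, le_refl 0, zero_le_one⟩

/-- The terminal endpoint of the interval component. -/
def head {n : ℕ} : LinkoidSource n := Sum.inl ⟨1, zero_le_one, le_refl 1⟩

/-- The velocity vector of a parametrized plane curve system at a point of its source.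
It is used only at double points, which are never endpoints of the interval. -/
noncomputable def velocity {n : ℕ} (f : LinkoidSource n → ℂ) (p : LinkoidSource n) : ℂ :=
  deriv (fun s : ℝ => f (p.shift s)) 0

end LinkoidSource

/-- The determinant of the pair of plane vectors `v`, `w`. -/
def planeDet (v w : ℂ) : ℝ := v.re * w.im - v.im * w.re

/-- An (oriented) 1-linkoid diagram: a generic immersion of one interval and finitely many circles
in the plane, whose only singularities are finitely many transverse double points away from the
endpoints, together with over/under information at each double point. -/
structure OneLinkoidDiagram where
  /-- the number of closed components -/
  numClosed : ℕ
  /-- the immersion -/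
  toPlane : LinkoidSource numClosed → ℂ
  /-- the points of the source which pass a crossing on the under-strand -/
  under : Set (LinkoidSource numClosed)
  smooth_open : ContDiffOn ℝ ∞
    (fun t : ℝ => toPlane (Sum.inl (Set.projIcc 0 1 zero_le_one t))) (Set.Icc 0 1)
  smooth_closed : ∀ i, ContDiff ℝ ∞ (fun t : ℝ => toPlane (Sum.inr (i, (t : UnitAddCircle))))
  immersed_open : ∀ t ∈ Set.Icc (0 : ℝ) 1,
    derivWithin (fun t : ℝ => toPlane (Sum.inl (Set.projIcc 0 1 zero_le_one t)))
      (Set.Icc 0 1) t ≠ 0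
  immersed_closed : ∀ i (t : ℝ),
    deriv (fun t : ℝ => toPlane (Sum.inr (i, (t : UnitAddCircle)))) t ≠ 0
  leg_simple : ∀ q, toPlane q = toPlane LinkoidSource.leg → q = LinkoidSource.leg
  head_simple : ∀ q, toPlane q = toPlane LinkoidSource.head → q = LinkoidSource.head
  finite_double : {p | ∃ q, q ≠ p ∧ toPlane q = toPlane p}.Finite
  no_triple : ∀ p q r, p ≠ q → q ≠ r → p ≠ r →
    ¬ (toPlane p = toPlane q ∧ toPlane q = toPlane r)
  transverse : ∀ p q, p ≠ q → toPlane p = toPlane q →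
    planeDet (LinkoidSource.velocity toPlane p) (LinkoidSource.velocity toPlane q) ≠ 0
  under_double : ∀ p ∈ under, ∃ q, q ≠ p ∧ toPlane q = toPlane p
  under_iff : ∀ p q, p ≠ q → toPlane p = toPlane q → (p ∈ under ↔ q ∉ under)

namespace OneLinkoidDiagram

variable (D : OneLinkoidDiagram)

/-- The arcs of the diagram: the pieces into which the source is cut at the under-crossings. -/
def Arc : Type := ConnectedComponents {p : LinkoidSource D.numClosed // p ∉ D.under}

/-- The arc through a point that is not an under-crossing. -/
def arcOf (p : LinkoidSource D.numClosed) (hp : p ∉ D.under) : D.Arc :=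
  ConnectedComponents.mk (⟨p, hp⟩ : {p : LinkoidSource D.numClosed // p ∉ D.under})

/-- The arc `a` ends at the under-crossing `p`. -/
def IsIncoming (p : LinkoidSource D.numClosed) (a : D.Arc) : Prop :=
  ∀ᶠ s : ℝ in 𝓝[>] 0, ∃ h : p.shift (-s) ∉ D.under, D.arcOf (p.shift (-s)) h = a

/-- The arc `a` starts at the under-crossing `p`. -/
def IsOutgoing (p : LinkoidSource D.numClosed) (a : D.Arc) : Prop :=
  ∀ᶠ s : ℝ in 𝓝[>] 0, ∃ h : p.shift s ∉ D.under, D.arcOf (p.shift s) h = a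

/-- The sign of the crossing with over-point `o` and under-point `p` is that of this number. -/
noncomputable def crossingDet (o p : LinkoidSource D.numClosed) : ℝ :=
  planeDet (LinkoidSource.velocity D.toPlane o) (LinkoidSource.velocity D.toPlane p)

/-- The crossing relations. At a crossing with over-arc `y`, incoming under-arc `x` and outgoing
under-arc `z` the relation is `z = y ◃ x` if the crossing is positive and `x = y ◃ z` if it is
negative. -/
inductive CrossingRel : QuandleTerm D.Arc → QuandleTerm D.Arc → Prop
  | pos (o p : LinkoidSource D.numClosed) (ho : o ∉ D.under) (hp : p ∈ D.under)
      (h : D.toPlane o = D.toPlane p) (hpos : 0 < D.crossingDet o p)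
      (x z : D.Arc) (hx : D.IsIncoming p x) (hz : D.IsOutgoing p z) :
      CrossingRel (.of z) (.act (.of (D.arcOf o ho)) (.of x))
  | neg (o p : LinkoidSource D.numClosed) (ho : o ∉ D.under) (hp : p ∈ D.under)
      (h : D.toPlane o = D.toPlane p) (hneg : D.crossingDet o p < 0)
      (x z : D.Arc) (hx : D.IsIncoming p x) (hz : D.IsOutgoing p z) :
      CrossingRel (.of x) (.act (.of (D.arcOf o ho)) (.of z))

/-- The fundamental quandle `Q(D)`: generated by the arcs, one relation for each crossing. -/
abbrev FundamentalQuandle : Type := PresentedQuandle D.CrossingRel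

theorem leg_not_under : LinkoidSource.leg ∉ D.under := fun h => by
  obtain ⟨q, hq, e⟩ := D.under_double _ h
  exact hq (D.leg_simple q e)

theorem head_not_under : LinkoidSource.head ∉ D.under := fun h => by
  obtain ⟨q, hq, e⟩ := D.under_double _ h
  exact hq (D.head_simple q e)

/-- The fundamental pointed quandle `P(D) = (Q(D), l, h)`: its basepoints are the generators given
by the arc at the leg and the arc at the head. -/
def fundamentalPointedQuandle : PointedQuandle 2 where
  carrier := D.FundamentalQuandle
  basepoint := ![PresentedQuandle.of D.CrossingRel (D.arcOf LinkoidSource.leg D.leg_not_under),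
    PresentedQuandle.of D.CrossingRel (D.arcOf LinkoidSource.head D.head_not_under)]

/-- The (unpointed) quandle counting invariant: the number of colorings of `D` by `X`. -/
noncomputable def quandleCount (X : Type*) [Quandle X] : ℤ :=
  (Nat.card (D.FundamentalQuandle →◃ X) : ℤ)

/-- The pointed quandle counting invariant. -/
noncomputable def pointedQuandleCount (X : PointedQuandle.{u} 2) : ℤ :=
  (Nat.card (D.fundamentalPointedQuandle.Hom X) : ℤ)

/-- The quandle counting matrix; its rows and columns are indexed by the elements of `X`. -/
noncomputable def quandleCountingMatrix (X : Type*) [Quandle X] : Matrix X X ℤ :=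
  Matrix.of fun i j => D.pointedQuandleCount { carrier := X, basepoint := ![i, j] }

/-- `D` is only trivially colorable by `X`: every coloring of `D` by `X` is constant. -/
def OnlyTriviallyColorable (X : Type*) [Quandle X] : Prop :=
  ∀ f : D.FundamentalQuandle →◃ X, ∃ x : X, ∀ q, f q = x

end OneLinkoidDiagram

/-! ## Homomorphisms out of a presented quandle -/

/-! Each entry counts the fibre of `f ↦ (f l, f h)` on the set of colorings, so everything is formal
once that set is finite. Finiteness holds because a coloring is determined by its values on the arcs
(`PresentedQuandle.hom_ext`) and there are finitely many arcs (`finite_arc`); the latter is the only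
topological input.

Constant colorings make the diagonal entries positive, and the fibres partition all colorings, which
gives the sum. Composing colorings with `φ ∈ Aut(X)` shows that the matrix is invariant under `(i,
j) ↦ (φ i, φ j)`. Homogeneity and 2-homogeneity then say that `Aut(X)` is transitive on the diagonal
and on the off-diagonal pairs respectively. -/

theorem ShelfHom.map_invAct {Q X : Type*} [Rack Q] [Rack X] (f : Q →◃ X) (a b : Q) :
    f (a ◃⁻¹ b) = f a ◃⁻¹ f b := by
  rw [← Rack.left_cancel (f a), ← f.map_act, Rack.act_invAct_eq, Rack.act_invAct_eq]

/-- A homomorphism out of a presented quandle is determined by its values on the generators. -/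
theorem PresentedQuandle.hom_ext {A : Type} {R : QuandleTerm A → QuandleTerm A → Prop}
    {X : Type*} [Quandle X] {f g : PresentedQuandle R →◃ X}
    (h : ∀ a, f (PresentedQuandle.of R a) = g (PresentedQuandle.of R a)) : f = g := by
  have key : ∀ t, f (PresentedQuandle.mk R t) = g (PresentedQuandle.mk R t) := by
    intro t
    induction t with
    | of a => exact h a
    | act s t hs ht =>
      change f (PresentedQuandle.mk R s ◃ PresentedQuandle.mk R t) =
        g (PresentedQuandle.mk R s ◃ PresentedQuandle.mk R t)
      rw [f.map_act, g.map_act, hs, ht]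
    | invAct s t hs ht =>
      change f (PresentedQuandle.mk R s ◃⁻¹ PresentedQuandle.mk R t) =
        g (PresentedQuandle.mk R s ◃⁻¹ PresentedQuandle.mk R t)
      rw [f.map_invAct, g.map_invAct, hs, ht]
  refine ShelfHom.ext (funext ?_)
  rintro ⟨t⟩
  exact key t

theorem PresentedQuandle.finite_hom {A : Type} [Finite A]
    (R : QuandleTerm A → QuandleTerm A → Prop) (X : Type*) [Quandle X] [Finite X] :
    Finite (PresentedQuandle R →◃ X) :=
  Finite.of_injective (fun f (a : A) => f (PresentedQuandle.of R a)) fun _ _ h =>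
    PresentedQuandle.hom_ext fun a => congrFun h a

/-- The constant homomorphism to a quandle. -/
def ShelfHom.const (Q : Type*) {X : Type*} [Shelf Q] [Quandle X] (x : X) : Q →◃ X where
  toFun _ := x
  map_act' := Quandle.fix.symm

/-- Automorphisms of a quandle act on the homomorphisms into it. -/
def ShelfHom.postcomp {Q X : Type*} [Shelf Q] [Quandle X] (φ : quandleAut X) :
    (Q →◃ X) ≃ (Q →◃ X) where
  toFun f := ⟨fun q => (φ : Equiv.Perm X) (f q), fun {a b} => by
    rw [f.map_act]; exact φ.2 _ _⟩
  invFun f := ⟨fun q => ((φ⁻¹ : quandleAut X) : Equiv.Perm X) (f q), fun {a b} => by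
    rw [f.map_act]; exact (φ⁻¹).2 _ _⟩
  left_inv f := ShelfHom.ext (funext fun q => by
    change ((φ : Equiv.Perm X)⁻¹) ((φ : Equiv.Perm X) (f q)) = f q
    simp)
  right_inv f := ShelfHom.ext (funext fun q => by
    change (φ : Equiv.Perm X) ((φ : Equiv.Perm X)⁻¹ (f q)) = f q
    simp)

/-! ## Finiteness of the set of arcs -/

/-- If a space is covered by finitely many injectively parametrized curves, then the complement of
a finite set has finitely many connected components. -/
theorem finite_connectedComponents_compl {M κ : Type*} [TopologicalSpace M] [Finite κ]
    {U : Set M} (hU : U.Finite) (S : κ → Set ℝ) (γ : κ → ℝ → M)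
    (hS : ∀ k, (S k).OrdConnected) (hc : ∀ k, ContinuousOn (γ k) (S k))
    (hi : ∀ k, Set.InjOn (γ k) (S k)) (hcov : ∀ p, ∃ k, ∃ t ∈ S k, γ k t = p) :
    Finite (ConnectedComponents {p : M // p ∉ U}) := by
  have := hU.to_subtype
  choose k t htS hγ using hcov
  -- Two points on one curve with the same cut points before them have no cut point between them, so
  -- the segment joining them stays in the complement.
  have key : ∀ p q : {p : M // p ∉ U}, k p = k q →
      {u : U | ∃ s ∈ S (k p), γ (k p) s = u ∧ s < t p} =
        {u : U | ∃ s ∈ S (k q), γ (k q) s = u ∧ s < t q} → t p ≤ t q →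
      (p : ConnectedComponents {p : M // p ∉ U}) = q := by
    intro p q hk hset hle
    have hp := htS p
    have hγp := hγ p
    rw [hk] at hset hp hγp
    have hsub : Set.Icc (t p) (t q) ⊆ S (k q) := (hS (k q)).out hp (htS q)
    have hmiss : ∀ s ∈ Set.Icc (t p) (t q), γ (k q) s ∉ U := by
      intro s hs hsU
      have hsp : t p ≠ s := by
        rintro rfl
        exact p.2 (hγp ▸ hsU)
      have hsq : s ≠ t q := by
        rintro rfl
        exact q.2 (hγ q ▸ hsU)
      -- A cut point between `t p` and `t q` precedes `t q`, hence also `t p` by equality of the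
      -- sets; injectivity of the curve makes the two parameters equal, a contradiction.
      have hmem : (⟨_, hsU⟩ : U) ∈ {u : U | ∃ s ∈ S (k q), γ (k q) s = u ∧ s < t q} :=
        ⟨s, hsub hs, rfl, lt_of_le_of_ne hs.2 hsq⟩
      rw [← hset] at hmem
      obtain ⟨s', hs', he, hlt⟩ := hmem
      rw [hi (k q) hs' (hsub hs) he] at hlt
      exact absurd hs.1 (not_le.2 hlt)
    have himg : IsPreconnected
        (((↑) : {p : M // p ∉ U} → M) ⁻¹' (γ (k q) '' Set.Icc (t p) (t q))) := by
      have hind : Topology.IsInducing ((↑) : {p : M // p ∉ U} → M) := .subtypeVal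
      rw [← hind.isPreconnected_image, Set.image_preimage_eq_of_subset]
      · exact isPreconnected_Icc.image _ ((hc (k q)).mono hsub)
      · rintro _ ⟨s, hs, rfl⟩
        exact ⟨⟨_, hmiss s hs⟩, rfl⟩
    rw [ConnectedComponents.coe_eq_coe']
    exact himg.subset_connectedComponent ⟨t q, ⟨hle, le_rfl⟩, hγ q⟩ ⟨t p, ⟨le_rfl, hle⟩, hγp⟩
  -- A component may carry several labels (curve, earlier cut points), as when an arc passes the
  -- base point of a circle. Labelling one chosen representative per component suffices.
  refine Finite.of_injective
    (fun c : ConnectedComponents {p : M // p ∉ U} =>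
      ((k c.out.1, {u : U | ∃ s ∈ S (k c.out.1), γ (k c.out.1) s = u ∧ s < t c.out.1}) :
        κ × Set U)) fun c d h => ?_
  obtain ⟨h₁, h₂⟩ := Prod.mk.inj h
  rw [← Quotient.out_eq c, ← Quotient.out_eq d]
  rcases le_total (t c.out.1) (t d.out.1) with hle | hle
  · exact key _ _ h₁ h₂ hle
  · exact (key _ _ h₁.symm h₂.symm hle).symm

namespace OneLinkoidDiagram

theorem finite_under (D : OneLinkoidDiagram) : D.under.Finite :=
  D.finite_double.subset D.under_double

instance finite_arc (D : OneLinkoidDiagram) : Finite D.Arc := by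
  refine finite_connectedComponents_compl (κ := Option (Fin D.numClosed)) D.finite_under
    -- `none` is the interval and `some i` a circle; the half-open domain makes the circle's
    -- parametrization injective while still covering it.
    (fun k => k.elim (Set.Icc 0 1) fun _ => Set.Ico 0 1)
    (fun k t => k.elim (Sum.inl (Set.projIcc 0 1 zero_le_one t))
      fun i => Sum.inr (i, (t : UnitAddCircle))) ?_ ?_ ?_ ?_
  · rintro (_ | i)
    · exact Set.ordConnected_Icc
    · exact Set.ordConnected_Ico
  · rintro (_ | i)
    · exact (continuous_inl.comp continuous_projIcc).continuousOn
    · exact (continuous_inr.comp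
        (continuous_const.prodMk (AddCircle.continuous_mk' 1))).continuousOn
  · rintro (_ | i) s hs t ht h
    · have h' : Set.projIcc (0 : ℝ) 1 zero_le_one s = Set.projIcc 0 1 zero_le_one t :=
        Sum.inl.inj h
      rw [Set.projIcc_of_mem _ hs, Set.projIcc_of_mem _ ht] at h'
      exact congrArg Subtype.val h'
    · have h' : (s : UnitAddCircle) = t := (Prod.mk.inj (Sum.inr.inj h)).2
      have hs' : s ∈ Set.Ico (0 : ℝ) (0 + 1) := by simpa using hs
      have ht' : t ∈ Set.Ico (0 : ℝ) (0 + 1) := by simpa using ht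
      exact (AddCircle.coe_eq_coe_iff_of_mem_Ico hs' ht').1 h'
  · rintro (t | ⟨i, w⟩)
    · exact ⟨none, t, t.2, congrArg Sum.inl (Set.projIcc_val zero_le_one t)⟩
    · obtain ⟨t, ht, rfl⟩ : w ∈ ((↑) : ℝ → UnitAddCircle) '' Set.Ico 0 (0 + 1) := by
        rw [AddCircle.coe_image_Ico_eq]; trivial
      exact ⟨some i, t, by simpa using ht, rfl⟩

/-! ### Entries of the counting matrix -/

variable (D : OneLinkoidDiagram) (X : Type*) [Quandle X]

/-- The generator of the fundamental quandle at the leg. -/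
def legGen : D.FundamentalQuandle :=
  PresentedQuandle.of D.CrossingRel (D.arcOf LinkoidSource.leg D.leg_not_under)

/-- The generator of the fundamental quandle at the head. -/
def headGen : D.FundamentalQuandle :=
  PresentedQuandle.of D.CrossingRel (D.arcOf LinkoidSource.head D.head_not_under)

instance finite_coloring [Finite X] : Finite (D.FundamentalQuandle →◃ X) :=
  PresentedQuandle.finite_hom _ X

variable {X}

theorem quandleCountingMatrix_apply (i j : X) :
    D.quandleCountingMatrix X i j =
      (Nat.card {f : D.FundamentalQuandle →◃ X // f D.legGen = i ∧ f D.headGen = j} : ℤ) :=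
  congrArg Nat.cast <| Nat.card_congr <|
    Equiv.subtypeEquivRight fun _ => Fin.forall_fin_two

theorem quandleCountingMatrix_aut (φ : quandleAut X) (i j : X) :
    D.quandleCountingMatrix X ((φ : Equiv.Perm X) i) ((φ : Equiv.Perm X) j) =
      D.quandleCountingMatrix X i j := by
  rw [quandleCountingMatrix_apply, quandleCountingMatrix_apply]
  refine congrArg Nat.cast (Nat.card_congr ?_).symm
  refine (ShelfHom.postcomp φ).subtypeEquiv fun f => ?_
  exact (and_congr (φ : Equiv.Perm X).injective.eq_iff
    (φ : Equiv.Perm X).injective.eq_iff).symm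

theorem one_le_quandleCountingMatrix_diag [Finite X] (i : X) :
    1 ≤ D.quandleCountingMatrix X i i := by
  rw [quandleCountingMatrix_apply]
  have : Nonempty {f : D.FundamentalQuandle →◃ X // f D.legGen = i ∧ f D.headGen = i} :=
    ⟨⟨ShelfHom.const _ i, rfl, rfl⟩⟩
  exact_mod_cast Nat.card_pos

/-- Zeros off the diagonal force `f l = f h` for every coloring `f`. A diagonal entry 1 leaves room
only for the constant coloring, so `f` is constant. Conversely, a constant coloring is determined by
its value at the leg. -/
theorem quandleCountingMatrix_eq_one_iff [Finite X] [DecidableEq X] :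
    D.quandleCountingMatrix X = 1 ↔ D.OnlyTriviallyColorable X := by
  constructor
  · intro h f
    have hent : ∀ i j, D.quandleCountingMatrix X i j = (1 : Matrix X X ℤ) i j :=
      fun i j => by rw [h]
    have hlh : f D.legGen = f D.headGen := by
      by_contra hne
      have h0 := hent (f D.legGen) (f D.headGen)
      rw [Matrix.one_apply_ne hne, quandleCountingMatrix_apply] at h0
      -- Finiteness matters here: `Nat.card` is also 0 on infinite types.
      have h1 := Finite.card_eq_zero_iff.1 (Nat.cast_eq_zero.1 h0)
      exact h1.elim ⟨f, rfl, rfl⟩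
    have h0 := hent (f D.legGen) (f D.legGen)
    rw [Matrix.one_apply_eq, quandleCountingMatrix_apply] at h0
    have h1 := (Nat.card_eq_one_iff_unique.1 (Nat.cast_eq_one.1 h0)).1
    refine ⟨f D.legGen, fun q => ?_⟩
    have h2 := h1.elim ⟨f, rfl, hlh.symm⟩ ⟨ShelfHom.const _ (f D.legGen), rfl, rfl⟩
    exact congrArg (fun g : D.FundamentalQuandle →◃ X => g q) (Subtype.ext_iff.1 h2)
  · intro h
    ext i j
    rw [quandleCountingMatrix_apply]
    by_cases hij : i = j
    · subst hij
      rw [Matrix.one_apply_eq, Nat.cast_eq_one, Nat.card_eq_one_iff_unique]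
      refine ⟨⟨?_⟩, ⟨⟨ShelfHom.const _ i, rfl, rfl⟩⟩⟩
      rintro ⟨f, hf, -⟩ ⟨g, hg, -⟩
      obtain ⟨x, hx⟩ := h f
      obtain ⟨y, hy⟩ := h g
      refine Subtype.ext (ShelfHom.ext (funext fun q => ?_))
      exact (hx q).trans <| (hx _).symm.trans <| hf.trans <| hg.symm.trans <|
        (hy _).trans (hy q).symm
    · rw [Matrix.one_apply_ne hij, Nat.cast_eq_zero, Finite.card_eq_zero_iff]
      refine ⟨?_⟩
      rintro ⟨f, hf, hf'⟩
      obtain ⟨x, hx⟩ := h f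
      exact hij (hf.symm.trans <| (hx _).trans <| (hx _).symm.trans hf')

theorem sum_quandleCountingMatrix [Fintype X] :
    ∑ i : X, ∑ j : X, D.quandleCountingMatrix X i j = D.quandleCount X := by
  simp_rw [quandleCountingMatrix_apply]
  rw [← Fintype.sum_prod_type'
    (f := fun i j => (Nat.card {f : D.FundamentalQuandle →◃ X //
      f D.legGen = i ∧ f D.headGen = j} : ℤ)), quandleCount, ← Nat.cast_sum, ← Nat.card_sigma]
  refine congrArg Nat.cast (Nat.card_congr ?_)
  refine (Equiv.sigmaCongrRight fun p => Equiv.subtypeEquivRight fun f => ?_).trans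
    (Equiv.sigmaFiberEquiv fun f : D.FundamentalQuandle →◃ X => (f D.legGen, f D.headGen))
  rw [Prod.ext_iff]

end OneLinkoidDiagram

/-! ## Homogeneity -/

/-- In a finite `n`-homogeneous quandle, two tuples related by a permutation are related by an
automorphism. -/
theorem IsNHomogeneousQuandle.exists_aut {n : ℕ} {X : Type*} [Quandle X] [Finite X]
    (h : IsNHomogeneousQuandle n X) (v : Fin n → X) (σ : Equiv.Perm X) :
    ∃ φ ∈ quandleAut X, ∀ k, φ (v k) = σ (v k) := by
  -- Every `Aut(X)`-orbit lies in a single orbit of the symmetric group. The resulting surjection is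
  -- between finite sets of equal size, hence injective, so the orbits coincide.
  let F : MulAction.orbitRel.Quotient (quandleAut X) (Fin n → X) →
      MulAction.orbitRel.Quotient (Equiv.Perm X) (Fin n → X) :=
    Quotient.map' id fun _ _ ⟨g, hg⟩ => ⟨(g : Equiv.Perm X), hg⟩
  have hsurj : Function.Surjective F := by
    rintro ⟨w⟩
    exact ⟨Quotient.mk'' w, rfl⟩
  have : Finite (MulAction.orbitRel.Quotient (quandleAut X) (Fin n → X)) :=
    Quotient.finite _
  have hinj : Function.Injective F := (hsurj.bijective_of_nat_card_le h.le).1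
  have hF : F (Quotient.mk'' (σ • v)) = F (Quotient.mk'' v) := Quotient.sound' ⟨σ, rfl⟩
  obtain ⟨g, hg⟩ := Quotient.exact' (hinj hF)
  exact ⟨g, g.2, fun k => congrFun hg k⟩

theorem mainTheorem7 (L : OneLinkoidDiagram) (X : Type*) [Quandle X] [Fintype X] [DecidableEq X] :
    Finite (L.FundamentalQuandle →◃ X) ∧
    (∀ i j : X, 0 ≤ L.quandleCountingMatrix X i j) ∧
    (∀ i : X, 1 ≤ L.quandleCountingMatrix X i i) ∧
    (L.quandleCountingMatrix X = 1 ↔ L.OnlyTriviallyColorable X) ∧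
    (∑ i : X, ∑ j : X, L.quandleCountingMatrix X i j = L.quandleCount X) ∧
    (IsHomogeneousQuandle X →
      ∀ i j : X, L.quandleCountingMatrix X i i = L.quandleCountingMatrix X j j) ∧
    (IsNHomogeneousQuandle 2 X →
      ∀ i₁ j₁ i₂ j₂ : X, i₁ ≠ j₁ → i₂ ≠ j₂ →
        L.quandleCountingMatrix X i₁ j₁ = L.quandleCountingMatrix X i₂ j₂) := by
  refine ⟨inferInstance, fun i j => ?_, L.one_le_quandleCountingMatrix_diag,
    L.quandleCountingMatrix_eq_one_iff, L.sum_quandleCountingMatrix, fun h i j => ?_,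
    fun h i₁ j₁ i₂ j₂ h₁ h₂ => ?_⟩
  · rw [L.quandleCountingMatrix_apply]
    exact Nat.cast_nonneg _
  · obtain ⟨φ, hφ, rfl⟩ := h i j
    exact (L.quandleCountingMatrix_aut ⟨φ, hφ⟩ i i).symm
  · obtain ⟨σ, hσi, hσj⟩ : ∃ σ : Equiv.Perm X, σ i₁ = i₂ ∧ σ j₁ = j₂ := by
      have hne : Equiv.swap i₁ i₂ j₁ ≠ i₂ := fun e =>
        h₁ ((Equiv.swap i₁ i₂).injective ((Equiv.swap_apply_left _ _).trans e.symm))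
      refine ⟨Equiv.swap (Equiv.swap i₁ i₂ j₁) j₂ * Equiv.swap i₁ i₂, ?_, ?_⟩
      · rw [Equiv.Perm.mul_apply, Equiv.swap_apply_left,
          Equiv.swap_apply_of_ne_of_ne hne.symm h₂]
      · rw [Equiv.Perm.mul_apply, Equiv.swap_apply_left]
    obtain ⟨φ, hφ, hv⟩ := h.exists_aut ![i₁, j₁] σ
    have hi : φ i₁ = i₂ := (hv 0).trans hσi
    have hj : φ j₁ = j₂ := (hv 1).trans hσj
    rw [← hi, ← hj]
    exact (L.quandleCountingMatrix_aut ⟨φ, hφ⟩ i₁ j₁).symm
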